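/- Let $\mathbb K$ be $\mathbb R$ or $\mathbb C$; all spaces are over $\mathbb K$. For Banach spaces $X,Y$ let $S_X$ be the unit sphere of $X$ and $\mathcal L(X,Y)$ the space of bounded linear operators with the operator norm. The pair $(X,Y)$ has the Bishop–Phelps–Bollobás property if for every $0<\varepsilon<1$ there is $\eta>0$ such that for all $T\in\mathcal L(X,Y)$ with $\|T\|=1$ and $x_0\in S_X$ with $\|Tx_0\|>1-\eta$ there are $y_0\in S_X$ and $S\in\mathcal L(X,Y)$ with $\|S\|=1$, $\|Sy_0\|=1$, $\|y_0-x_0\|<\varepsilon$ and $\|S-T\|<\varepsilon$. Put $\Pi(X,Y)=\{(x,T)\in X\times\mathcal L(X,Y):\|T\|=\|x\|=\|Tx\|=1\}$ and, for $0<\varepsilon<1$, $$\eta(X,Y)(\varepsilon)=\inf\{1-\|Tx\| : x\in S_X,\ T\in\mathcal L(X,Y),\ \|T\|=1,\ \operatorname{dist}((x,T),\Pi(X,Y))\ge\varepsilon\},$$ where $\operatorname{dist}((x,T),\Pi(X,Y))=\inf\{\max\{\|x-y\|,\|T-S\|\}:(y,S)\in\Pi(X,Y)\}$ and $\inf\emptyset=\infty$.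 (a) For arbitrary (positive) measures $\mu$ and $\nu$, the pair $(L_1(\mu),L_1(\nu))$ has the Bishop–Phelps–Bollobás property. (b) There is a function $\eta:(0,1)\to(0,\infty)$ such that $\eta(L_1(\mu),L_1(\nu))(\varepsilon)\ge\eta(\varepsilon)$ for all measures $\mu,\nu$ and all $0<\varepsilon<1$. (c) Let $m_1,m_2$ be finite regular positive Borel measures on compact Hausdorff spaces $J_1,J_2$, let $0<\varepsilon<1$, and let $T\in\mathcal L(L_1(m_1),L_1(m_2))$ and $f\in L_1(m_1)$ satisfy $\|T\|=\|f\|=1$ and $$\|Tf\|>1-\frac{\varepsilon^{18}}{5^3\,2^{27}}.$$ Then there are $S\in\mathcal L(L_1(m_1),L_1(m_2))$ and $g\in L_1(m_1)$ with $\|S\|=\|g\|=\|Sg\|=1$, $\|f-g\|<4\varepsilon$ and $\|T-S\|<4\sqrt\varepsilon$. -/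

import Mathlib

open MeasureTheory
open scoped ENNReal

universe u v w

/-- The pair `(X, Y)` of normed spaces over `𝕜` has the Bishop–Phelps–Bollobás property. -/
def HasBPBp (𝕜 : Type w) [RCLike 𝕜] (X : Type u) (Y : Type v)
    [NormedAddCommGroup X] [NormedSpace 𝕜 X] [NormedAddCommGroup Y] [NormedSpace 𝕜 Y] : Prop :=
  ∀ ε : ℝ, 0 < ε → ε < 1 → ∃ η : ℝ, 0 < η ∧
    ∀ (T : X →L[𝕜] Y) (x₀ : X), ‖T‖ = 1 → ‖x₀‖ = 1 → 1 - η < ‖T x₀‖ →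
      ∃ (y₀ : X) (S : X →L[𝕜] Y), ‖y₀‖ = 1 ∧ ‖S‖ = 1 ∧
        ‖S y₀‖ = 1 ∧ ‖y₀ - x₀‖ < ε ∧ ‖S - T‖ < ε

/-- The set `Π(X, Y)` of pairs `(x, T)` such that `‖T‖ = ‖x‖ = ‖T x‖ = 1`. -/
def normAttainingPairs (𝕜 : Type w) [RCLike 𝕜] (X : Type u) (Y : Type v)
    [NormedAddCommGroup X] [NormedSpace 𝕜 X] [NormedAddCommGroup Y] [NormedSpace 𝕜 Y] :
    Set (X × (X →L[𝕜] Y)) :=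
  {p | ‖p.2‖ = 1 ∧ ‖p.1‖ = 1 ∧ ‖p.2 p.1‖ = 1}

/-- The modulus `η(X, Y)(ε)`, i.e. the infimum of `1 - ‖T x‖` over the norm-one `x` and the
norm-one `T` for which `(x, T)` has distance at least `ε` from `Π(X, Y)`, where the distance on
`X × L(X, Y)` is the maximum of the two distances. Both infima are taken in `[0, ∞]`, so that
an infimum over the empty set is `∞`; note that `0 ≤ 1 - ‖T x‖` for these `x` and `T`. -/
noncomputable def bpbModulus (𝕜 : Type w) [RCLike 𝕜] (X : Type u) (Y : Type v)
    [NormedAddCommGroup X] [NormedSpace 𝕜 X] [NormedAddCommGroup Y] [NormedSpace 𝕜 Y]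
    (ε : ℝ) : ℝ≥0∞ :=
  ⨅ (x : X) (T : X →L[𝕜] Y) (_ : ‖x‖ = 1) (_ : ‖T‖ = 1)
    (_ : ENNReal.ofReal ε ≤ Metric.infEDist (x, T) (normAttainingPairs 𝕜 X Y)),
    ENNReal.ofReal (1 - ‖T x‖)

/-! A unimodular multiplier on the target replaces `T f` by its modulus, so the real integral of `T
f` is nearly 1. On sets `a`, the real part of the integral of `T (f 1_a)` is a signed measure
dominated by the finite measure `m = |f| μ`. Its Hahn decomposition against `(1 - δ) m` gives a set
`A` of almost full `m`-measure on all of whose measurable subsets the integral is at least `(1 - δ)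
m` (`exists_hahn_of_additive`). Then `g` is the normalized restriction of `f` to `A`.

In the coordinates of `|g| μ`, each `T 1_a` has integral close to its norm, hence is close to `|T
1_a|`. These moduli are only subadditive in `a`; their sums over finer and finer partitions converge
in norm to an additive positive `P`, in effect the modulus of the operator, and an error bound
additive in `a` survives the refinement (`exists_additive_near`). A small multiple of a fixed
positive unit vector tops `‖P a‖` up to the measure of `a`, which yields an operator `S` preserving
norms of indicators (`L1.exists_near_of_integral`). `L1.exists_extension` carries it to `L¹(μ)`,
keeping `T` off the support of `g`. Only the finite measures `|f| μ` and `|g| μ` are ever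
decomposed, so `μ` and `ν` are arbitrary and the constants universal. -/

open Filter Topology

/-! ### Additive majorants of subadditive set functions -/

section AdditiveMajorant

open scoped Classical in
/-- The sum of `n` over the pieces into which the elements of `s` cut `a`. -/
noncomputable def partitionSum {B L : Type*} [BooleanAlgebra B] [AddCommMonoid L] (n : B → L)
    (s : Finset B) (a : B) : L :=
  ∑ t ∈ s.powerset, n (a ⊓ (t.inf id ⊓ (s \ t).inf compl))

variable {B L : Type*} [BooleanAlgebra B]

theorem partitionSum_empty [AddCommMonoid L] (n : B → L) (a : B) : partitionSum n ∅ a = n a := by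
  simp [partitionSum]

open scoped Classical in
theorem partitionSum_insert [AddCommMonoid L] (n : B → L) {s : Finset B} {b : B} (hb : b ∉ s)
    (a : B) :
    partitionSum n (insert b s) a = partitionSum n s (a ⊓ bᶜ) + partitionSum n s (a ⊓ b) := by
  unfold partitionSum
  rw [Finset.sum_powerset_insert hb]
  congr 1
  · refine Finset.sum_congr rfl fun t ht => ?_
    have hbt : b ∉ t := fun h => hb (Finset.mem_powerset.1 ht h)
    rw [Finset.insert_sdiff_of_notMem _ hbt, Finset.inf_insert]
    congr 1
    ac_rfl
  · refine Finset.sum_congr rfl fun t ht => ?_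
    have hbt : b ∉ t := fun h => hb (Finset.mem_powerset.1 ht h)
    have : insert b s \ insert b t = s \ t := by
      ext x
      simp only [Finset.mem_sdiff, Finset.mem_insert]
      constructor
      · tauto
      · rintro ⟨h1, h2⟩
        refine ⟨Or.inr h1, ?_⟩
        rintro (rfl | h)
        exacts [hb h1, h2 h]
    rw [this, Finset.inf_insert]
    congr 1
    simp only [id]
    ac_rfl

theorem partitionSum_sup_le [AddCommMonoid L] [PartialOrder L] [IsOrderedAddMonoid L] {n : B → L}
    (hn : ∀ a b, Disjoint a b → n (a ⊔ b) ≤ n a + n b) (s : Finset B) {a b : B}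
    (hab : Disjoint a b) : partitionSum n s (a ⊔ b) ≤ partitionSum n s a + partitionSum n s b := by
  unfold partitionSum
  rw [← Finset.sum_add_distrib]
  refine Finset.sum_le_sum fun t _ => ?_
  rw [inf_sup_right]
  exact hn _ _ (hab.mono inf_le_left inf_le_left)

/-- A new element of `s` cuts every piece in two, and subadditivity says that cutting never lowers
the sum. -/
theorem partitionSum_mono [AddCommMonoid L] [PartialOrder L] [IsOrderedAddMonoid L] {n : B → L}
    (hn : ∀ a b, Disjoint a b → n (a ⊔ b) ≤ n a + n b) (a : B) :
    Monotone fun s => partitionSum n s a := by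
  classical
  have hins : ∀ (s : Finset B) (b : B), partitionSum n s a ≤ partitionSum n (insert b s) a := by
    intro s b
    by_cases hb : b ∈ s
    · rw [Finset.insert_eq_of_mem hb]
    · rw [partitionSum_insert n hb]
      have hd : Disjoint (a ⊓ bᶜ) (a ⊓ b) :=
        (disjoint_compl_left (a := b)).mono inf_le_right inf_le_right
      have h := partitionSum_sup_le hn s hd
      rwa [← inf_sup_left, sup_comm, sup_compl_eq_top, inf_top_eq] at h
  intro s t hst
  have : ∀ r : Finset B, partitionSum n s a ≤ partitionSum n (r ∪ s) a := by
    intro r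
    induction r using Finset.induction_on with
    | empty => simp
    | insert b r _ ih => exact ih.trans (by rw [Finset.insert_union]; exact hins _ _)
  simpa [Finset.sdiff_union_of_subset hst] using this (t \ s)

/-- Once `a` itself is among the cuts, every piece of `a ⊔ b` lies inside `a` or inside `b`. This is
eventually so along finer `s`, which makes the limit additive. -/
theorem partitionSum_sup [AddCommMonoid L] {n : B → L} (hn : n ⊥ = 0) {s : Finset B}
    {a b : B} (ha : a ∈ s) (hab : Disjoint a b) :
    partitionSum n s (a ⊔ b) = partitionSum n s a + partitionSum n s b := by
  classical
  obtain ⟨r, har, rfl⟩ : ∃ r, a ∉ r ∧ insert a r = s :=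
    ⟨s.erase a, Finset.notMem_erase _ _, Finset.insert_erase ha⟩
  have h0 : partitionSum n r ⊥ = 0 := by simp [partitionSum, hn]
  have hb : b ⊓ aᶜ = b := inf_eq_left.2 (le_compl_iff_disjoint_left.2 hab)
  simp only [partitionSum_insert n har, inf_sup_right, inf_compl_self, hab.symm.eq_bot, h0, hb,
    inf_idem, bot_sup_eq, sup_bot_eq, zero_add, add_zero]
  exact add_comm _ _

/-- A bound which is additive passes from `n` to its sums over partitions. -/
theorem norm_partitionSum_le {F G : Type*} [AddCommMonoid L] [FunLike G L F]
    [NormedAddCommGroup F] [AddMonoidHomClass G L F] (i : G) {n : B → L}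
    {t : B → F} (ht : ∀ a b, Disjoint a b → t (a ⊔ b) = t a + t b)
    {M : B → ℝ} (hM : ∀ a b, Disjoint a b → M (a ⊔ b) = M a + M b)
    (h : ∀ a, ‖i (n a) - t a‖ ≤ M a) (s : Finset B) (a : B) :
    ‖i (partitionSum n s a) - t a‖ ≤ M a := by
  classical
  induction s using Finset.induction_on generalizing a with
  | empty => simpa [partitionSum_empty] using h a
  | insert b s hb ih =>
    have hd : Disjoint (a ⊓ bᶜ) (a ⊓ b) :=
      (disjoint_compl_left (a := b)).mono inf_le_right inf_le_right
    have hsup : a = a ⊓ bᶜ ⊔ a ⊓ b := by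
      rw [← inf_sup_left, sup_comm, sup_compl_eq_top, inf_top_eq]
    rw [partitionSum_insert n hb, map_add]
    calc _ = ‖(i (partitionSum n s (a ⊓ bᶜ)) - t (a ⊓ bᶜ))
          + (i (partitionSum n s (a ⊓ b)) - t (a ⊓ b))‖ := by
            congr 1
            conv_lhs => rw [hsup, ht _ _ hd, ← hsup]
            abel
      _ ≤ M (a ⊓ bᶜ) + M (a ⊓ b) := (norm_add_le _ _).trans (add_le_add (ih _) (ih _))
      _ = M a := by rw [← hM _ _ hd, ← hsup]

/-- A monotone, norm bounded net in a space whose norm is additive on the positive cone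
converges. -/
theorem Monotone.exists_tendsto_of_norm_add {ι : Type*} [Nonempty ι] [SemilatticeSup ι]
    [NormedAddCommGroup L] [PartialOrder L] [IsOrderedAddMonoid L] [CompleteSpace L]
    (hL : ∀ x y : L, 0 ≤ x → 0 ≤ y → ‖x + y‖ = ‖x‖ + ‖y‖) {V : ι → L} (hV : Monotone V)
    (hV0 : ∀ i, 0 ≤ V i) {C : ℝ} (hC : ∀ i, ‖V i‖ ≤ C) : ∃ p, Tendsto V atTop (𝓝 p) := by
  -- Additivity of the norm reduces the Cauchy property to that of the bounded increasing real net
  -- of norms.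
  have hdiff : ∀ {i j}, i ≤ j → ‖V j - V i‖ = ‖V j‖ - ‖V i‖ := by
    intro i j hij
    have := hL (V i) (V j - V i) (hV0 i) (sub_nonneg.2 (hV hij))
    rw [add_sub_cancel] at this
    linarith
  have hmono : Monotone fun i => ‖V i‖ := fun i j hij => by
    have := hdiff hij
    have := norm_nonneg (V j - V i)
    simp only
    linarith
  have hbdd : BddAbove (Set.range fun i => ‖V i‖) := ⟨C, by rintro _ ⟨i, rfl⟩; exact hC i⟩
  have hcau : CauchySeq fun i => ‖V i‖ := (tendsto_atTop_ciSup hmono hbdd).cauchySeq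
  refine cauchySeq_tendsto_of_complete (Metric.cauchySeq_iff'.2 fun ε hε => ?_)
  obtain ⟨N, hN⟩ := Metric.cauchySeq_iff'.1 hcau ε hε
  refine ⟨N, fun i hi => ?_⟩
  rw [dist_eq_norm, hdiff hi]
  exact (le_abs_self _).trans_lt (by simpa [Real.dist_eq] using hN i hi)

/-- `P` is the limit of the partition sums, a total variation of `n`. Both bounds by `M` hold for
every partition sum because they are additive, so they pass to the limit. -/
theorem exists_additive_near {F G : Type*} [NormedAddCommGroup L] [PartialOrder L]
    [IsOrderedAddMonoid L] [CompleteSpace L] [ClosedIciTopology L]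
    (hL : ∀ x y : L, 0 ≤ x → 0 ≤ y → ‖x + y‖ = ‖x‖ + ‖y‖)
    [NormedAddCommGroup F] [FunLike G L F] [AddMonoidHomClass G L F] (i : G) (hi : Continuous i)
    {n : B → L} (hn0 : ∀ a, 0 ≤ n a) (hn : ∀ a b, Disjoint a b → n (a ⊔ b) ≤ n a + n b)
    {M : B → ℝ} (hM : ∀ a b, Disjoint a b → M (a ⊔ b) = M a + M b) (hnM : ∀ a, ‖n a‖ ≤ M a)
    {t : B → F} (ht : ∀ a b, Disjoint a b → t (a ⊔ b) = t a + t b)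
    {c : ℝ} (h : ∀ a, ‖i (n a) - t a‖ ≤ c * M a) :
    ∃ P : B → L, (∀ a b, Disjoint a b → P (a ⊔ b) = P a + P b) ∧ (∀ a, 0 ≤ P a) ∧
      (∀ a, ‖n a‖ ≤ ‖P a‖) ∧ (∀ a, ‖P a‖ ≤ M a) ∧ ∀ a, ‖i (P a) - t a‖ ≤ c * M a := by
  classical
  have hV0 : ∀ s a, 0 ≤ partitionSum n s a := fun s a => Finset.sum_nonneg fun _ _ => hn0 _
  have hVM : ∀ s a, ‖partitionSum n s a‖ ≤ M a := fun s a => by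
    simpa using norm_partitionSum_le (AddMonoidHom.id L) (t := fun _ => (0 : L)) (by simp) hM
      (by simpa using hnM) s a
  have hMbot : M ⊥ = 0 := by simpa using hM ⊥ ⊥ disjoint_bot_left
  have hnbot : n ⊥ = 0 := norm_le_zero_iff.1 (hMbot ▸ hnM ⊥)
  choose P hP using fun a => (partitionSum_mono hn a).exists_tendsto_of_norm_add hL
    (fun s => hV0 s a) (fun s => hVM s a)
  refine ⟨P, fun a b hab => ?_, fun a => ?_, fun a => ?_, fun a => ?_, fun a => ?_⟩
  · refine tendsto_nhds_unique (hP _) (((hP a).add (hP b)).congr' ?_)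
    filter_upwards [eventually_ge_atTop {a}] with s hs
    exact (partitionSum_sup hnbot (Finset.singleton_subset_iff.1 hs) hab).symm
  · exact ge_of_tendsto' (hP a) fun s => hV0 s a
  · refine ge_of_tendsto' (hP a).norm fun s => ?_
    have hs := partitionSum_mono hn a (Finset.empty_subset s)
    simp only [partitionSum_empty] at hs
    have := hL _ _ (hn0 a) (sub_nonneg.2 hs)
    rw [add_sub_cancel] at this
    linarith [norm_nonneg (partitionSum n s a - n a)]
  · exact le_of_tendsto' (hP a).norm fun s => hVM s a
  · refine le_of_tendsto' (((hi.tendsto _).comp (hP a)).sub_const _).norm fun s => ?_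
    exact norm_partitionSum_le i ht (fun a b hab => by rw [hM a b hab, mul_add]) h s a

end AdditiveMajorant

/-! ### Modulus and integral in L¹ -/

section L1

open Filter

variable {𝕜 : Type*} [RCLike 𝕜] {Ω : Type*} [MeasurableSpace Ω] {ν : Measure Ω}

theorem L1.norm_add_of_nonneg (x y : Lp ℝ 1 ν) (hx : 0 ≤ x) (hy : 0 ≤ y) :
    ‖x + y‖ = ‖x‖ + ‖y‖ := by
  rw [L1.norm_eq_integral_norm, L1.norm_eq_integral_norm, L1.norm_eq_integral_norm,
    ← integral_add (L1.integrable_coeFn x).norm (L1.integrable_coeFn y).norm]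
  refine integral_congr_ae ?_
  filter_upwards [Lp.coeFn_add x y, (Lp.coeFn_nonneg x).2 hx, (Lp.coeFn_nonneg y).2 hy]
    with a h1 h2 h3
  rw [h1, Pi.add_apply, Real.norm_of_nonneg h2, Real.norm_of_nonneg h3,
    Real.norm_of_nonneg (add_nonneg h2 h3)]

/-- The pointwise norm of an integrable function. -/
noncomputable def L1.pointwiseNorm (y : Lp 𝕜 1 ν) : Lp ℝ 1 ν :=
  (L1.integrable_coeFn y).norm.toL1 _

theorem L1.coeFn_pointwiseNorm (y : Lp 𝕜 1 ν) : L1.pointwiseNorm y =ᵐ[ν] fun x => ‖y x‖ :=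
  Integrable.coeFn_toL1 _

theorem L1.pointwiseNorm_nonneg (y : Lp 𝕜 1 ν) : 0 ≤ L1.pointwiseNorm y := by
  rw [← Lp.coeFn_nonneg]
  filter_upwards [L1.coeFn_pointwiseNorm y] with a h
  rw [h]
  exact norm_nonneg _

theorem L1.norm_pointwiseNorm (y : Lp 𝕜 1 ν) : ‖L1.pointwiseNorm y‖ = ‖y‖ := by
  rw [L1.norm_eq_integral_norm, L1.norm_eq_integral_norm]
  refine integral_congr_ae ?_
  filter_upwards [L1.coeFn_pointwiseNorm y] with a h
  rw [h, norm_norm]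

theorem L1.pointwiseNorm_add_le (x y : Lp 𝕜 1 ν) :
    L1.pointwiseNorm (x + y) ≤ L1.pointwiseNorm x + L1.pointwiseNorm y := by
  rw [← Lp.coeFn_le]
  filter_upwards [Lp.coeFn_add x y, Lp.coeFn_add (L1.pointwiseNorm x) (L1.pointwiseNorm y),
    L1.coeFn_pointwiseNorm x, L1.coeFn_pointwiseNorm y, L1.coeFn_pointwiseNorm (x + y)]
    with a h1 h2 h3 h4 h5
  rw [h5, h2, Pi.add_apply, h3, h4, h1]
  exact norm_add_le _ _

variable (𝕜) in
/-- The embedding of the real into the real or complex integrable functions. -/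
noncomputable def L1.ofReal : Lp ℝ 1 ν →L[ℝ] Lp 𝕜 1 ν :=
  (RCLike.ofRealCLM (K := 𝕜)).compLpL 1 ν

theorem L1.coeFn_ofReal (y : Lp ℝ 1 ν) : L1.ofReal 𝕜 y =ᵐ[ν] fun x => (y x : 𝕜) :=
  ContinuousLinearMap.coeFn_compLpL _ _

theorem L1.norm_ofReal (y : Lp ℝ 1 ν) : ‖L1.ofReal 𝕜 y‖ = ‖y‖ := by
  rw [L1.norm_eq_integral_norm, L1.norm_eq_integral_norm]
  refine integral_congr_ae ?_
  filter_upwards [L1.coeFn_ofReal (𝕜 := 𝕜) y] with a h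
  rw [h, RCLike.norm_ofReal, Real.norm_eq_abs]

/-- The square of the left side is `2‖z‖(‖z‖ - re z)`, and AM-GM with weight `s` bounds its root by
terms that integrate linearly. -/
theorem RCLike.norm_ofReal_norm_sub_le (z : 𝕜) {s : ℝ} (hs : 0 < s) :
    ‖((‖z‖ : ℝ) : 𝕜) - z‖ ≤ s / 2 * ‖z‖ + (‖z‖ - RCLike.re z) / s := by
  have hre : 0 ≤ ‖z‖ - RCLike.re z := sub_nonneg.2 (RCLike.re_le_norm z)
  refine abs_le_of_sq_le_sq' ?_ (by positivity) |>.2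
  have h1 : ‖((‖z‖ : ℝ) : 𝕜) - z‖ ^ 2 = 2 * ‖z‖ * (‖z‖ - RCLike.re z) := by
    have h2 := RCLike.norm_sq_eq_def (z := ((‖z‖ : ℝ) : 𝕜) - z)
    have h3 := RCLike.norm_sq_eq_def (z := z)
    simp only [map_sub, RCLike.ofReal_re, RCLike.ofReal_im] at h2
    nlinarith
  have h4 : (s / 2 * ‖z‖ + (‖z‖ - RCLike.re z) / s) ^ 2 - 2 * ‖z‖ * (‖z‖ - RCLike.re z)
      = (s / 2 * ‖z‖ - (‖z‖ - RCLike.re z) / s) ^ 2 := by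
    field_simp
    ring
  nlinarith [sq_nonneg (s / 2 * ‖z‖ - (‖z‖ - RCLike.re z) / s)]

theorem L1.integral_re_le_norm (y : Lp 𝕜 1 ν) : ∫ x, RCLike.re (y x) ∂ν ≤ ‖y‖ := by
  rw [L1.norm_eq_integral_norm]
  exact integral_mono (L1.integrable_coeFn y).re (L1.integrable_coeFn y).norm
    fun x => RCLike.re_le_norm _

/-- If the integral of `y` is close to its norm, then `y` is close to its modulus. -/
theorem L1.norm_ofReal_pointwiseNorm_sub_le (y : Lp 𝕜 1 ν) {δ t : ℝ} (hδ : 0 < δ)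
    (hy : ‖y‖ ≤ t) (h : (1 - δ) * t ≤ ∫ x, RCLike.re (y x) ∂ν) :
    ‖L1.ofReal 𝕜 (L1.pointwiseNorm y) - y‖ ≤ Real.sqrt (2 * δ) * t := by
  -- This weight balances the two terms: `s / 2 = δ / s`.
  set s := Real.sqrt (2 * δ)
  have hs : 0 < s := Real.sqrt_pos.2 (by positivity)
  have hss : s * s = 2 * δ := Real.mul_self_sqrt (by positivity)
  have hn := (L1.integrable_coeFn y).norm
  have hr := (L1.integrable_coeFn y).re
  calc ‖L1.ofReal 𝕜 (L1.pointwiseNorm y) - y‖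
      ≤ ∫ x, (s / 2 * ‖y x‖ + (‖y x‖ - RCLike.re (y x)) / s) ∂ν := by
        rw [L1.norm_eq_integral_norm]
        refine integral_mono_ae (L1.integrable_coeFn _).norm
          ((hn.const_mul _).add ((hn.sub hr).div_const _)) ?_
        filter_upwards [Lp.coeFn_sub (L1.ofReal 𝕜 (L1.pointwiseNorm y)) y,
          L1.coeFn_ofReal (𝕜 := 𝕜) (L1.pointwiseNorm y), L1.coeFn_pointwiseNorm y] with a h1 h2 h3
        rw [h1, Pi.sub_apply, h2, h3]
        exact RCLike.norm_ofReal_norm_sub_le _ hs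
    _ = s / 2 * ‖y‖ + (‖y‖ - ∫ x, RCLike.re (y x) ∂ν) / s := by
        have hd : Integrable (fun x => (‖y x‖ - RCLike.re (y x)) / s) ν := (hn.sub hr).div_const _
        rw [integral_add (hn.const_mul _) hd, integral_const_mul,
          integral_div, integral_sub hn hr, L1.norm_eq_integral_norm]
    _ ≤ s / 2 * t + (δ * t) / s := by
        gcongr
        linarith
    _ = s * t := by
        field_simp
        rw [sq, hss]
        ring

end L1

/-! ### Operators on L¹ of a finite measure from additive set functions -/

section Indicator

variable {𝕜 : Type*} [RCLike 𝕜] {Ω : Type*} [MeasurableSpace Ω]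

variable (𝕜) in
/-- The indicator function of a measurable set in `L¹` of a finite measure. -/
noncomputable def L1.indicator (m : Measure Ω) [IsFiniteMeasure m]
    (a : {s : Set Ω // MeasurableSet s}) : Lp 𝕜 1 m :=
  indicatorConstLp 1 a.2 (measure_ne_top m a) 1

variable {m : Measure Ω} [IsFiniteMeasure m]

theorem L1.norm_indicator (a : {s : Set Ω // MeasurableSet s}) :
    ‖L1.indicator 𝕜 m a‖ = m.real a := by
  simp [L1.indicator, norm_indicatorConstLp]

theorem MeasurableSet.Subtype.disjoint_coe {a b : {s : Set Ω // MeasurableSet s}}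
    (hab : Disjoint a b) : Disjoint (a : Set Ω) b := by
  rw [Set.disjoint_iff_inter_eq_empty]
  exact congrArg Subtype.val hab.eq_bot

theorem L1.indicator_sup (a b : {s : Set Ω // MeasurableSet s}) (hab : Disjoint a b) :
    L1.indicator 𝕜 m (a ⊔ b) = L1.indicator 𝕜 m a + L1.indicator 𝕜 m b :=
  indicatorConstLp_disjoint_union a.2 b.2 _ _ (MeasurableSet.Subtype.disjoint_coe hab) 1

theorem Measure.real_subtype_sup (a b : {s : Set Ω // MeasurableSet s}) (hab : Disjoint a b) :
    m.real ((a ⊔ b : {s : Set Ω // MeasurableSet s}) : Set Ω) = m.real a + m.real b :=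
  measureReal_union (MeasurableSet.Subtype.disjoint_coe hab) b.2

variable {F : Type*} [NormedAddCommGroup F] [NormedSpace 𝕜 F]

theorem L1.norm_add_of_disjoint_support {μ : Measure Ω} {f g : Ω → 𝕜} (hf : MemLp f 1 μ)
    (hg : MemLp g 1 μ) (h : Disjoint (Function.support f) (Function.support g)) :
    ‖hf.toLp f + hg.toLp g‖ = ‖hf.toLp f‖ + ‖hg.toLp g‖ := by
  rw [L1.norm_eq_integral_norm, L1.norm_eq_integral_norm, L1.norm_eq_integral_norm,
    ← integral_add (L1.integrable_coeFn _).norm (L1.integrable_coeFn _).norm]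
  refine integral_congr_ae ?_
  filter_upwards [Lp.coeFn_add (hf.toLp f) (hg.toLp g), hf.coeFn_toLp, hg.coeFn_toLp]
    with a h1 h2 h3
  rw [h1, Pi.add_apply, h2, h3]
  by_cases ha : f a = 0
  · simp [ha]
  · have : g a = 0 := by
      by_contra hb
      exact Set.disjoint_left.1 h ha hb
    simp [this]

/-- The L¹ norm is additive over disjoint supports, so the bound passes from indicators to simple
functions with the same constant, then by density to all. -/
theorem L1.opNorm_le_of_indicator (R : Lp 𝕜 1 m →L[𝕜] F) {C : ℝ} (hC : 0 ≤ C)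
    (h : ∀ a, ‖R (L1.indicator 𝕜 m a)‖ ≤ C * m.real a) : ‖R‖ ≤ C := by
  refine R.opNorm_le_bound hC fun u => ?_
  induction u using Lp.induction ENNReal.one_ne_top with
  | indicatorConst c hs hμs =>
    rename_i s
    have : ((Lp.simpleFunc.indicatorConst 1 hs hμs.ne c : Lp.simpleFunc 𝕜 1 m) : Lp 𝕜 1 m)
        = c • L1.indicator 𝕜 m ⟨s, hs⟩ := by
      rw [Lp.simpleFunc.coe_indicatorConst, L1.indicator]
      ext1
      filter_upwards [indicatorConstLp_coeFn (p := 1) (hs := hs) (hμs := hμs.ne) (c := c),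
        indicatorConstLp_coeFn (p := 1) (hs := hs) (hμs := hμs.ne) (c := (1 : 𝕜)),
        Lp.coeFn_smul c (indicatorConstLp 1 hs hμs.ne (1 : 𝕜))] with x h1 h2 h3
      rw [h1, h3, Pi.smul_apply, h2]
      by_cases hx : x ∈ s <;> simp [hx]
    rw [this, map_smul, norm_smul, norm_smul, L1.norm_indicator]
    calc _ ≤ ‖c‖ * (C * m.real s) := by gcongr; exact h ⟨s, hs⟩
      _ = _ := by ring
  | add hf hg hfg ihf ihg =>
    rw [map_add, L1.norm_add_of_disjoint_support hf hg hfg, mul_add]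
    exact (norm_add_le _ _).trans (add_le_add ihf ihg)
  | isClosed => exact isClosed_le (by fun_prop) (by fun_prop)

/-- A finitely additive function on the measurable sets which is dominated by the measure extends
to an operator on `L¹`. -/
theorem L1.exists_clm_of_additive [CompleteSpace F] [NormedSpace ℝ F] [IsScalarTower ℝ 𝕜 F]
    (D : {s : Set Ω // MeasurableSet s} → F)
    (hadd : ∀ a b, Disjoint a b → D (a ⊔ b) = D a + D b) {C : ℝ} (hC : 0 ≤ C)
    (hD : ∀ a, ‖D a‖ ≤ C * m.real a) :
    ∃ R : Lp 𝕜 1 m →L[𝕜] F, ‖R‖ ≤ C ∧ ∀ a, R (L1.indicator 𝕜 m a) = D a := by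
  classical
  -- The set function integrated by `setToL1`; only finite additivity and domination by `m` are
  -- needed. The value 0 on nonmeasurable sets is a dummy.
  let E : Set Ω → 𝕜 →L[ℝ] F := fun s =>
    if h : MeasurableSet s then
      (ContinuousLinearMap.toSpanSingleton 𝕜 (D ⟨s, h⟩)).restrictScalars ℝ else 0
  have hE : ∀ (s) (h : MeasurableSet s) (c : 𝕜), E s c = c • D ⟨s, h⟩ := fun s h c => by
    simp [E, h]
  have hdom : DominatedFinMeasAdditive m E C := by
    refine ⟨fun s t hs ht _ _ hst => ?_, fun s hs _ => ?_⟩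
    · ext
      rw [_root_.add_apply, hE s hs, hE t ht, hE _ (hs.union ht), ← smul_add]
      congr 1
      refine hadd ⟨s, hs⟩ ⟨t, ht⟩ ?_
      rw [disjoint_iff]
      exact Subtype.ext (Set.disjoint_iff_inter_eq_empty.1 hst)
    · refine ContinuousLinearMap.opNorm_le_bound _ (by positivity) fun c => ?_
      rw [hE s hs, norm_smul, mul_comm]
      gcongr
      exact hD ⟨s, hs⟩
  have hsmul : ∀ c : 𝕜, ∀ s x, E s (c • x) = c • E s x := by
    intro c s x
    by_cases hs : MeasurableSet s
    · rw [hE s hs, hE s hs, smul_assoc]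
    · simp [E, hs]
  have hind : ∀ a, L1.setToL1' 𝕜 hdom hsmul (L1.indicator 𝕜 m a) = D a := fun a => by
    rw [← L1.setToL1_eq_setToL1', L1.indicator, L1.setToL1_indicatorConstLp hdom a.2, hE _ a.2,
      one_smul]
  refine ⟨L1.setToL1' 𝕜 hdom hsmul, L1.opNorm_le_of_indicator _ hC fun a => ?_, hind⟩
  rw [hind]
  exact hD a

/-- An operator from `L¹` of a finite measure which almost preserves the integrals of the
indicator functions is close to a positive operator preserving the norms of the indicator
functions. -/
theorem L1.exists_near_of_integral {Ω' : Type*} [MeasurableSpace Ω'] {ν : Measure Ω'}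
    (T : Lp 𝕜 1 m →L[𝕜] Lp 𝕜 1 ν) (hT : ‖T‖ ≤ 1) {w : Lp ℝ 1 ν} (hw0 : 0 ≤ w) (hw1 : ‖w‖ = 1)
    {δ : ℝ} (hδ : 0 < δ)
    (h : ∀ a : {s : Set Ω // MeasurableSet s}, (1 - δ) * m.real a ≤ ∫ x, RCLike.re (T (L1.indicator 𝕜 m a) x) ∂ν) :
    ∃ S : Lp 𝕜 1 m →L[𝕜] Lp 𝕜 1 ν, ‖S‖ ≤ 1 ∧ (∀ a, ‖S (L1.indicator 𝕜 m a)‖ = m.real a) ∧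
      ‖T - S‖ ≤ Real.sqrt (2 * δ) + δ := by
  have hTa : ∀ a, ‖T (L1.indicator 𝕜 m a)‖ ≤ m.real a := fun a => by
    simpa [L1.norm_indicator] using T.le_of_opNorm_le hT (L1.indicator 𝕜 m a)
  have hTadd : ∀ a b, Disjoint a b → T (L1.indicator 𝕜 m (a ⊔ b)) =
      T (L1.indicator 𝕜 m a) + T (L1.indicator 𝕜 m b) := fun a b hab => by
    rw [L1.indicator_sup a b hab, map_add]
  obtain ⟨P, hPadd, hP0, hnP, hPM, hPT⟩ := exists_additive_near (L1.norm_add_of_nonneg (ν := ν))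
    (L1.ofReal 𝕜) (L1.ofReal 𝕜).continuous
    (n := fun a => L1.pointwiseNorm (T (L1.indicator 𝕜 m a)))
    (M := fun a => m.real a) (t := fun a => T (L1.indicator 𝕜 m a)) (c := Real.sqrt (2 * δ))
    (fun a => L1.pointwiseNorm_nonneg _)
    (fun a b hab => by simpa only [hTadd a b hab] using L1.pointwiseNorm_add_le _ _)
    (fun a b => Measure.real_subtype_sup a b)
    (fun a => by rw [L1.norm_pointwiseNorm]; exact hTa a)
    hTadd (fun a => L1.norm_ofReal_pointwiseNorm_sub_le _ hδ (hTa a) (h a))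
  have hδP : ∀ a : {s : Set Ω // MeasurableSet s}, (1 - δ) * m.real a ≤ ‖P a‖ := fun a => by
    refine ((h a).trans (L1.integral_re_le_norm _)).trans ?_
    rw [← L1.norm_pointwiseNorm]
    exact hnP a
  -- The deficit `m a - ‖P a‖` lies between 0 and `δ * m a`, and is additive because the norm is
  -- additive on positive elements.
  let Q : {s : Set Ω // MeasurableSet s} → Lp ℝ 1 ν := fun a => P a + (m.real a - ‖P a‖) • w
  have hQM : ∀ a, ‖Q a‖ = m.real a := fun a => by
    have h0 : 0 ≤ m.real a - ‖P a‖ := sub_nonneg.2 (hPM a)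
    have h1 : 0 ≤ (m.real a - ‖P a‖) • w := by
      rw [← Lp.coeFn_nonneg]
      filter_upwards [Lp.coeFn_smul (m.real a - ‖P a‖) w, (Lp.coeFn_nonneg w).2 hw0] with x h2 h3
      rw [h2]
      exact mul_nonneg h0 h3
    rw [L1.norm_add_of_nonneg _ _ (hP0 a) h1, norm_smul, hw1, Real.norm_of_nonneg h0]
    ring
  have hQadd : ∀ a b, Disjoint a b → Q (a ⊔ b) = Q a + Q b := fun a b hab => by
    simp only [Q]
    rw [Measure.real_subtype_sup a b hab, hPadd a b hab, L1.norm_add_of_nonneg _ _ (hP0 a) (hP0 b)]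
    module
  -- Building the difference `R = S - T` gives the distance bound directly as an operator norm.
  obtain ⟨R, hR, hRD⟩ := L1.exists_clm_of_additive (𝕜 := 𝕜) (m := m)
    (fun a => L1.ofReal 𝕜 (Q a) - T (L1.indicator 𝕜 m a))
    (fun a b hab => by rw [hQadd a b hab, hTadd a b hab, map_add]; abel)
    (C := Real.sqrt (2 * δ) + δ) (by positivity)
    (fun a => by
      have h0 : 0 ≤ m.real a - ‖P a‖ := sub_nonneg.2 (hPM a)
      calc _ = ‖(L1.ofReal 𝕜 (P a) - T (L1.indicator 𝕜 m a))
              + L1.ofReal 𝕜 ((m.real a - ‖P a‖) • w)‖ := by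
            simp only [Q, map_add]
            congr 1
            abel
        _ ≤ Real.sqrt (2 * δ) * m.real a + (m.real a - ‖P a‖) := by
            refine (norm_add_le _ _).trans (add_le_add (hPT a) ?_)
            rw [L1.norm_ofReal, norm_smul, hw1, Real.norm_of_nonneg h0, mul_one]
        _ ≤ _ := by linarith [hδP a])
  have hS : ∀ a, ‖(T + R) (L1.indicator 𝕜 m a)‖ = m.real a := fun a => by
    rw [_root_.add_apply, hRD, add_sub_cancel, L1.norm_ofReal, hQM]
  refine ⟨T + R, L1.opNorm_le_of_indicator _ zero_le_one fun a => by rw [hS, one_mul], hS, ?_⟩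
  rwa [sub_add_cancel_left, norm_neg]

end Indicator

/-! ### Change of density -/

section Multiplication

variable {𝕜 : Type*} [RCLike 𝕜] {Ω : Type*} [MeasurableSpace Ω] {μ₁ μ₂ : Measure Ω}

/-- Makes multiplication by `k` well defined on classes: `u` and `v` can differ on a set of positive
`μ₂`-measure only where `k` vanishes. -/
theorem ae_mul_eq_of_withDensity_le {k : Ω → 𝕜} (hk : Measurable k)
    (h : μ₂.withDensity (fun x => ‖k x‖ₑ) ≤ μ₁) {u v : Ω → 𝕜} (huv : u =ᵐ[μ₁] v) :
    (fun x => k x * u x) =ᵐ[μ₂] fun x => k x * v x := by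
  have h1 : u =ᵐ[μ₂.withDensity fun x => ‖k x‖ₑ] v :=
    (Measure.absolutelyContinuous_of_le h).ae_le huv
  filter_upwards [(ae_withDensity_iff hk.enorm).1 h1] with x hx
  by_cases hkx : k x = 0
  · simp [hkx]
  · rw [hx (by simpa using hkx)]

theorem lintegral_enorm_mul_eq {k : Ω → 𝕜} (hk : Measurable k) (u : Lp 𝕜 1 μ₁) :
    ∫⁻ x, ‖k x * u x‖ₑ ∂μ₂ = ∫⁻ x, ‖u x‖ₑ ∂μ₂.withDensity fun x => ‖k x‖ₑ := by
  rw [lintegral_withDensity_eq_lintegral_mul _ hk.enorm (L1.measurable_coeFn u).enorm]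
  simp [enorm_mul]

theorem integrable_mul_of_withDensity_le {k : Ω → 𝕜} (hk : Measurable k)
    (h : μ₂.withDensity (fun x => ‖k x‖ₑ) ≤ μ₁) (u : Lp 𝕜 1 μ₁) :
    Integrable (fun x => k x * u x) μ₂ := by
  refine ⟨(hk.mul (L1.measurable_coeFn u)).aestronglyMeasurable, ?_⟩
  rw [HasFiniteIntegral, lintegral_enorm_mul_eq hk]
  exact (lintegral_mono' h le_rfl).trans_lt (L1.hasFiniteIntegral_coeFn u)

/-- Multiplication by `k` as a contraction between `L¹` spaces of two measures. -/
noncomputable def L1.mulCLM (k : Ω → 𝕜) (hk : Measurable k)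
    (h : μ₂.withDensity (fun x => ‖k x‖ₑ) ≤ μ₁) : Lp 𝕜 1 μ₁ →L[𝕜] Lp 𝕜 1 μ₂ :=
  LinearMap.mkContinuous
    { toFun := fun u => (integrable_mul_of_withDensity_le hk h u).toL1 _
      map_add' := fun u v => by
        rw [← Integrable.toL1_add, Integrable.toL1_eq_toL1_iff]
        filter_upwards [ae_mul_eq_of_withDensity_le hk h (Lp.coeFn_add u v)] with x hx
        rw [hx, Pi.add_apply, Pi.add_apply, mul_add]
      map_smul' := fun c u => by
        rw [RingHom.id_apply, ← Integrable.toL1_smul', Integrable.toL1_eq_toL1_iff]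
        filter_upwards [ae_mul_eq_of_withDensity_le hk h (Lp.coeFn_smul c u)] with x hx
        rw [hx, Pi.smul_apply, Pi.smul_apply, smul_eq_mul, smul_eq_mul, mul_left_comm] }
    1 fun u => by
      rw [one_mul, LinearMap.coe_mk, AddHom.coe_mk, Integrable.norm_toL1_eq_lintegral_enorm,
        lintegral_enorm_mul_eq hk, L1.norm_def]
      exact ENNReal.toReal_mono (L1.hasFiniteIntegral_coeFn u).ne (lintegral_mono' h le_rfl)

variable {k : Ω → 𝕜} (hk : Measurable k)

theorem L1.norm_mulCLM_le (h : μ₂.withDensity (fun x => ‖k x‖ₑ) ≤ μ₁) : ‖L1.mulCLM k hk h‖ ≤ 1 :=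
  LinearMap.mkContinuous_norm_le _ zero_le_one _

theorem L1.coeFn_mulCLM (h : μ₂.withDensity (fun x => ‖k x‖ₑ) ≤ μ₁) (u : Lp 𝕜 1 μ₁) :
    L1.mulCLM k hk h u =ᵐ[μ₂] fun x => k x * u x :=
  (integrable_mul_of_withDensity_le hk h u).coeFn_toL1

theorem L1.norm_mulCLM_apply (h : μ₂.withDensity (fun x => ‖k x‖ₑ) = μ₁) (u : Lp 𝕜 1 μ₁) :
    ‖L1.mulCLM k hk h.le u‖ = ‖u‖ := by
  have : L1.mulCLM k hk h.le u = (integrable_mul_of_withDensity_le hk h.le u).toL1 _ := rfl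
  rw [this, Integrable.norm_toL1_eq_lintegral_enorm, lintegral_enorm_mul_eq hk, L1.norm_def, h]

theorem L1.coeFn_mulCLM_mulCLM {μ₃ : Measure Ω} {l : Ω → 𝕜} (hl : Measurable l)
    (h : μ₂.withDensity (fun x => ‖k x‖ₑ) ≤ μ₁) (h' : μ₃.withDensity (fun x => ‖l x‖ₑ) ≤ μ₂)
    (u : Lp 𝕜 1 μ₁) :
    L1.mulCLM l hl h' (L1.mulCLM k hk h u) =ᵐ[μ₃] fun x => l x * (k x * u x) :=
  (L1.coeFn_mulCLM hl h' _).trans (ae_mul_eq_of_withDensity_le hl h' (L1.coeFn_mulCLM hk h u))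

theorem withDensity_withDensity_inv_le {μ : Measure Ω} {k : Ω → 𝕜} (hk : Measurable k) :
    (μ.withDensity fun x => ‖k x‖ₑ).withDensity (fun x => ‖(k x)⁻¹‖ₑ) ≤ μ := by
  have hi : Measurable fun x => ‖(k x)⁻¹‖ₑ := hk.inv.enorm
  rw [← withDensity_mul _ hk.enorm hi]
  conv_rhs => rw [← withDensity_one (μ := μ)]
  refine withDensity_mono (ae_of_all _ fun x => ?_)
  rw [Pi.mul_apply, ← enorm_mul]
  by_cases hx : k x = 0
  · simp [hx]
  · simp [hx]

/-- An operator on the range of multiplication by `k` extends to the whole space,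
agreeing with a given operator on functions supported on the zero set of `k`. -/
theorem L1.exists_extension {F : Type*} [NormedAddCommGroup F] [NormedSpace 𝕜 F] {μ : Measure Ω}
    (T : Lp 𝕜 1 μ →L[𝕜] F) (hT : ‖T‖ ≤ 1)
    (S : Lp 𝕜 1 (μ.withDensity fun x => ‖k x‖ₑ) →L[𝕜] F) (hS : ‖S‖ ≤ 1) :
    ∃ R : Lp 𝕜 1 μ →L[𝕜] F, ‖R‖ ≤ 1 ∧ (∀ u, R (L1.mulCLM k hk le_rfl u) = S u) ∧
      ‖T - R‖ ≤ ‖T.comp (L1.mulCLM k hk le_rfl) - S‖ := by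
  set J : Lp 𝕜 1 (μ.withDensity fun x => ‖k x‖ₑ) →L[𝕜] Lp 𝕜 1 μ := L1.mulCLM k hk le_rfl with hJ
  -- Division by `k`, with `0⁻¹ = 0`: a left inverse of `J`, while `J ∘ Q` is restriction to `{k ≠
  -- 0}`.
  set Q : Lp 𝕜 1 μ →L[𝕜] Lp 𝕜 1 (μ.withDensity fun x => ‖k x‖ₑ) :=
    L1.mulCLM (fun x => (k x)⁻¹) hk.inv (withDensity_withDensity_inv_le hk) with hQ
  have hJn : ∀ u, ‖J u‖ = ‖u‖ := L1.norm_mulCLM_apply hk rfl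
  have hJQ : ∀ u, J (Q u) =ᵐ[μ] fun x => k x * ((k x)⁻¹ * u x) := fun u =>
    L1.coeFn_mulCLM_mulCLM hk.inv hk _ _ u
  have hQJ : ∀ u, Q (J u) = u := fun u => by
    have h0 : J (Q (J u)) = J u := by
      ext1
      filter_upwards [hJQ (J u), L1.coeFn_mulCLM hk le_rfl u] with x h1 h2
      rw [h1, h2]
      by_cases hx : k x = 0
      · simp [hx]
      · field_simp
    rw [← sub_eq_zero, ← norm_eq_zero, ← hJn, map_sub, h0, sub_self, norm_zero]
  have hsplit : ∀ u, ‖Q u‖ + ‖u - J (Q u)‖ = ‖u‖ := fun u => by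
    rw [← hJn, L1.norm_eq_integral_norm, L1.norm_eq_integral_norm, L1.norm_eq_integral_norm,
      ← integral_add (L1.integrable_coeFn _).norm (L1.integrable_coeFn _).norm]
    refine integral_congr_ae ?_
    filter_upwards [hJQ u, Lp.coeFn_sub u (J (Q u))] with x h1 h2
    rw [h2, Pi.sub_apply, h1]
    by_cases hx : k x = 0
    · simp [hx]
    · simp [hx]
  -- By `hsplit` the space is an ℓ¹-sum of the two supports, so gluing two contractions gives a
  -- contraction.
  refine ⟨S.comp Q + T.comp (ContinuousLinearMap.id 𝕜 _ - J.comp Q), ?_, fun u => ?_, ?_⟩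
  · refine ContinuousLinearMap.opNorm_le_bound _ zero_le_one fun u => ?_
    rw [one_mul, ← hsplit u]
    refine (norm_add_le _ _).trans (add_le_add ?_ ?_)
    · simpa using S.le_of_opNorm_le hS (Q u)
    · simpa using T.le_of_opNorm_le hT (u - J (Q u))
  · simp [hQJ]
  · have : T - (S.comp Q + T.comp (ContinuousLinearMap.id 𝕜 _ - J.comp Q)) =
        (T.comp J - S).comp Q := by
      ext1 u
      simp
      abel
    rw [this]
    refine (ContinuousLinearMap.opNorm_comp_le _ _).trans ?_
    exact mul_le_of_le_one_right (norm_nonneg _) (L1.norm_mulCLM_le _ _)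

end Multiplication

/-! ### Hahn decomposition for dominated additive functions -/

section Hahn

open Filter Topology

variable {Ω : Type*} [MeasurableSpace Ω]

theorem MeasurableSet.Subtype.additive_iUnion {F : Type*} [AddCommGroup F]
    {D : {s : Set Ω // MeasurableSet s} → F}
    (hadd : ∀ a b, Disjoint a b → D (a ⊔ b) = D a + D b) {f : ℕ → Set Ω}
    (hf : ∀ i, MeasurableSet (f i)) (hd : Pairwise (Function.onFun Disjoint f)) (n : ℕ) :
    D ⟨⋃ i, f i, .iUnion hf⟩ = ∑ i ∈ Finset.range n, D ⟨f i, hf i⟩ +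
      D ⟨⋃ i, f (n + i), .iUnion fun i => hf (n + i)⟩ := by
  induction n with
  | zero => simp
  | succ n ih =>
    rw [ih, Finset.sum_range_succ, add_assoc, ← hadd]
    · congr 2
      refine Subtype.ext ?_
      change ⋃ i, f (n + i) = f n ∪ ⋃ i, f (n + 1 + i)
      have := sup_iSup_nat_succ fun i => f (n + i)
      simp only [add_zero, add_assoc, add_comm 1] at this ⊢
      exact this.symm
    · rw [disjoint_iff]
      refine Subtype.ext ?_
      change f n ∩ ⋃ i, f (n + 1 + i) = ∅
      rw [← Set.disjoint_iff_inter_eq_empty, Set.disjoint_iUnion_right]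
      exact fun i => hd (by omega)

variable {m : Measure Ω} [IsFiniteMeasure m]

/-- A finitely additive real function dominated by a finite measure is a signed measure. -/
theorem exists_signedMeasure_of_additive {D : {s : Set Ω // MeasurableSet s} → ℝ}
    (hadd : ∀ a b, Disjoint a b → D (a ⊔ b) = D a + D b) (hD : ∀ a, |D a| ≤ m.real a) :
    ∃ v : SignedMeasure Ω, ∀ a : {s : Set Ω // MeasurableSet s}, v a = D a := by
  classical
  have hbot : D ⊥ = 0 := by simpa using hadd ⊥ ⊥ disjoint_bot_left
  refine ⟨⟨fun s => if h : MeasurableSet s then D ⟨s, h⟩ else 0, ?_, ?_, ?_⟩, ?_⟩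
  · rw [dif_pos MeasurableSet.empty]
    exact hbot
  · intro s hs
    rw [dif_neg hs]
  · intro f hf hd
    simp only [hf, MeasurableSet.iUnion hf, dif_pos]
    have hM : HasSum (fun i => m.real (f i)) (m.real (⋃ i, f i)) := by
      simpa [hf, MeasurableSet.iUnion hf] using m.toSignedMeasure.m_iUnion hf hd
    have hs : Summable fun i => D ⟨f i, hf i⟩ :=
      Summable.of_norm_bounded hM.summable fun i => hD ⟨f i, hf i⟩
    rw [hs.hasSum_iff_tendsto_nat]
    -- Countable additivity comes from domination: the tails have vanishing `m`-measure.
    have hM0 : Tendsto (fun n => m.real (⋃ i, f (n + i))) atTop (𝓝 0) := by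
      have := hM.tendsto_sum_nat.const_sub (m.real (⋃ i, f i))
      rw [sub_self] at this
      refine this.congr fun n => ?_
      rw [sub_eq_iff_eq_add']
      exact MeasurableSet.Subtype.additive_iUnion
        (D := fun a => m.real a) (fun a b => Measure.real_subtype_sup a b) hf hd n
    have hD0 : Tendsto (fun n => D ⟨⋃ i, f (n + i), .iUnion fun i => hf (n + i)⟩) atTop (𝓝 0) :=
      squeeze_zero_norm (fun n => hD _) hM0
    have := hD0.const_sub (D ⟨⋃ i, f i, .iUnion hf⟩)
    rw [sub_zero] at this
    refine this.congr fun n => ?_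
    rw [sub_eq_iff_eq_add]
    exact MeasurableSet.Subtype.additive_iUnion hadd hf hd n
  · intro a
    change dite _ _ _ = _
    rw [dif_pos a.2]

/-- The Hahn decomposition for the difference of a finitely additive function dominated by `m`
and a multiple of `m`. -/
theorem exists_hahn_of_additive {D : {s : Set Ω // MeasurableSet s} → ℝ}
    (hadd : ∀ a b, Disjoint a b → D (a ⊔ b) = D a + D b) (hD : ∀ a, |D a| ≤ m.real a) (c : ℝ) :
    ∃ A : {s : Set Ω // MeasurableSet s}, (∀ a ≤ A, c * m.real a ≤ D a) ∧
      D Aᶜ ≤ c * m.real (Aᶜ : {s : Set Ω // MeasurableSet s}) := by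
  obtain ⟨v, hv⟩ := exists_signedMeasure_of_additive hadd hD
  have hval : ∀ a : {s : Set Ω // MeasurableSet s},
      (v - c • m.toSignedMeasure) a = D a - c * m.real a := fun a => by
    simp [hv, a.2]
  obtain ⟨A, hA, hpos, hneg⟩ := (v - c • m.toSignedMeasure).exists_compl_positive_negative
  refine ⟨⟨A, hA⟩, fun a ha => ?_, ?_⟩
  · have := (VectorMeasure.restrict_le_restrict_iff _ _ hA).1 hpos a.2 ha
    rw [hval] at this
    simpa using this
  · have := (VectorMeasure.restrict_le_restrict_iff _ _ hA.compl).1 hneg hA.compl le_rfl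
    have h2 := hval ⟨Aᶜ, hA.compl⟩
    rw [h2] at this
    exact sub_nonpos.1 this

end Hahn

/-! ### The approximation theorem -/

section BishopPhelpsBollobas

variable {𝕜 : Type*} [RCLike 𝕜] {Ω₁ Ω₂ : Type*} [MeasurableSpace Ω₁] [MeasurableSpace Ω₂]
  {μ : Measure Ω₁} {ν : Measure Ω₂}

variable (𝕜 ν) in
/-- The real part of the integral as a functional on `L¹`. -/
noncomputable def L1.reIntegral : Lp 𝕜 1 ν →L[ℝ] ℝ :=
  RCLike.reCLM.comp L1.integralCLM

theorem L1.reIntegral_apply (y : Lp 𝕜 1 ν) :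
    L1.reIntegral 𝕜 ν y = ∫ x, RCLike.re (y x) ∂ν := by
  have h : L1.reIntegral 𝕜 ν y = RCLike.re (∫ x, y x ∂ν) := by
    rw [← L1.integral_eq_integral]
    simp only [L1.reIntegral, L1.integral_def]
    rfl
  rw [h]
  exact (integral_re (L1.integrable_coeFn y)).symm

theorem L1.abs_reIntegral_le (y : Lp 𝕜 1 ν) : |L1.reIntegral 𝕜 ν y| ≤ ‖y‖ := by
  rw [abs_le']
  refine ⟨?_, ?_⟩
  · rw [L1.reIntegral_apply]
    exact L1.integral_re_le_norm y
  · rw [← map_neg, ← norm_neg, L1.reIntegral_apply]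
    exact L1.integral_re_le_norm (-y)

theorem isFiniteMeasure_withDensity_enorm (f : Lp 𝕜 1 μ) :
    IsFiniteMeasure (μ.withDensity fun x => ‖f x‖ₑ) :=
  isFiniteMeasure_withDensity (L1.hasFiniteIntegral_coeFn f).ne

/-- The case of the approximation theorem in which the integral of `T f` is almost one. -/
theorem L1.exists_approx_of_reIntegral (T : Lp 𝕜 1 μ →L[𝕜] Lp 𝕜 1 ν) (f : Lp 𝕜 1 μ)
    (hT : ‖T‖ ≤ 1) (hf : ‖f‖ = 1) {δ η : ℝ} (hδ0 : 0 < δ) (hηδ : η ≤ δ) (hη1 : η ≤ 1)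
    (h : 1 - η < ∫ x, RCLike.re (T f x) ∂ν) :
    ∃ (S : Lp 𝕜 1 μ →L[𝕜] Lp 𝕜 1 ν) (g : Lp 𝕜 1 μ), ‖S‖ ≤ 1 ∧ ‖g‖ = 1 ∧ ‖S g‖ = 1 ∧
      ‖f - g‖ ≤ 2 * (η / δ) ∧ ‖T - S‖ ≤ Real.sqrt (2 * δ) + δ := by
  have hk : Measurable f := L1.measurable_coeFn f
  set m : Measure Ω₁ := μ.withDensity fun x => ‖f x‖ₑ with hm
  have : IsFiniteMeasure m := isFiniteMeasure_withDensity_enorm f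
  -- Multiplying by `f` rather than `|f|` absorbs the phase: the constant 1 goes to `f`.
  set J : Lp 𝕜 1 m →L[𝕜] Lp 𝕜 1 μ := L1.mulCLM f hk le_rfl with hJ
  have hJn : ∀ u, ‖J u‖ = ‖u‖ := L1.norm_mulCLM_apply hk rfl
  have hJind : ∀ a, J (L1.indicator 𝕜 m a) =ᵐ[μ] (a : Set Ω₁).indicator f := fun a => by
    filter_upwards [L1.coeFn_mulCLM hk le_rfl (L1.indicator 𝕜 m a),
      ae_mul_eq_of_withDensity_le hk le_rfl (indicatorConstLp_coeFn (p := 1) (hs := a.2)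
        (hμs := measure_ne_top m a) (c := (1 : 𝕜)))] with x h1 h2
    rw [h1]
    refine h2.trans ?_
    by_cases hx : x ∈ (a : Set Ω₁) <;> simp [hx]
  have hJtop : J (L1.indicator 𝕜 m ⊤) = f := by
    ext1
    filter_upwards [hJind ⊤] with x hx
    rw [hx]
    exact Set.indicator_of_mem (Set.mem_univ x) _
  have hm1 : m.real Set.univ = 1 := by
    have := hJn (L1.indicator 𝕜 m ⊤)
    rw [hJtop, hf, L1.norm_indicator] at this
    exact this.symm
  have hTa : ∀ u, ‖T (J u)‖ ≤ ‖u‖ := fun u => by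
    rw [← hJn]
    simpa using T.le_of_opNorm_le hT (J u)
  obtain ⟨A, hA, hAc⟩ := exists_hahn_of_additive (m := m)
    (D := fun a => L1.reIntegral 𝕜 ν (T (J (L1.indicator 𝕜 m a))))
    (fun a b hab => by rw [L1.indicator_sup a b hab, map_add, map_add, map_add])
    (fun a => ((L1.abs_reIntegral_le _).trans (hTa _)).trans_eq (L1.norm_indicator a)) (1 - δ)
  have hAA : m.real A + m.real (Aᶜ : {s : Set Ω₁ // MeasurableSet s}) = 1 := by
    rw [← hm1]
    exact measureReal_add_measureReal_compl A.2
  have hsplit : L1.indicator 𝕜 m ⊤ = L1.indicator 𝕜 m A + L1.indicator 𝕜 m Aᶜ := by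
    rw [← L1.indicator_sup _ _ disjoint_compl_right, sup_compl_eq_top]
  set α := m.real A with hα
  -- From `1 - η < α + (1 - δ)(1 - α)`.
  have hα1 : 1 - η / δ < α := by
    rw [← L1.reIntegral_apply, ← hJtop, hsplit, map_add, map_add, map_add] at h
    have h1 : L1.reIntegral 𝕜 ν (T (J (L1.indicator 𝕜 m A))) ≤ α :=
      (le_abs_self _).trans (((L1.abs_reIntegral_le _).trans (hTa _)).trans_eq (L1.norm_indicator A))
    have h2 : δ * (1 - α) < η := by
      rw [← hAA]
      nlinarith
    rw [← lt_div_iff₀' hδ0] at h2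
    linarith
  have hα0 : 0 < α := by
    have : η / δ ≤ 1 := (div_le_one hδ0).2 hηδ
    linarith
  have hα1' : α ≤ 1 := by
    have : 0 ≤ m.real (Aᶜ : {s : Set Ω₁ // MeasurableSet s}) := measureReal_nonneg
    linarith
  -- the normalized restriction of `f` to `A`
  set g : Lp 𝕜 1 μ := ((α⁻¹ : ℝ) : 𝕜) • J (L1.indicator 𝕜 m A) with hg
  have hgk : Measurable g := L1.measurable_coeFn g
  set m' : Measure Ω₁ := μ.withDensity fun x => ‖g x‖ₑ with hm'
  have : IsFiniteMeasure m' := isFiniteMeasure_withDensity_enorm g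
  set J' : Lp 𝕜 1 m' →L[𝕜] Lp 𝕜 1 μ := L1.mulCLM g hgk le_rfl with hJ'
  have hJ'n : ∀ u, ‖J' u‖ = ‖u‖ := L1.norm_mulCLM_apply hgk rfl
  have hJ'ind : ∀ a, J' (L1.indicator 𝕜 m' a) =
      ((α⁻¹ : ℝ) : 𝕜) • J (L1.indicator 𝕜 m (a ⊓ A)) := fun a => by
    ext1
    filter_upwards [L1.coeFn_mulCLM hgk le_rfl (L1.indicator 𝕜 m' a),
      ae_mul_eq_of_withDensity_le hgk le_rfl (indicatorConstLp_coeFn (p := 1) (hs := a.2)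
        (hμs := measure_ne_top m' a) (c := (1 : 𝕜))), hJind (a ⊓ A), hJind A,
      Lp.coeFn_smul ((α⁻¹ : ℝ) : 𝕜) (J (L1.indicator 𝕜 m (a ⊓ A))),
      Lp.coeFn_smul ((α⁻¹ : ℝ) : 𝕜) (J (L1.indicator 𝕜 m A))] with x h1 h2 h3 h4 h5 h6
    rw [h1, h5, Pi.smul_apply, h3]
    refine h2.trans ?_
    rw [hg, h6, Pi.smul_apply, h4]
    change _ = _ • (((a : Set Ω₁) ∩ A).indicator f x)
    by_cases hx : x ∈ (a : Set Ω₁) <;> by_cases hxA : x ∈ (A : Set Ω₁) <;> simp [hx, hxA]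
  have hαnorm : ‖((α⁻¹ : ℝ) : 𝕜)‖ = α⁻¹ := by
    rw [RCLike.norm_ofReal, abs_of_pos (inv_pos.2 hα0)]
  have hm'a : ∀ a : {s : Set Ω₁ // MeasurableSet s},
      m'.real a = α⁻¹ * m.real (a ⊓ A : {s : Set Ω₁ // MeasurableSet s}) := fun a => by
    rw [← L1.norm_indicator (𝕜 := 𝕜) (m := m') a, ← hJ'n, hJ'ind, norm_smul, hJn,
      L1.norm_indicator, hαnorm]
  have hm'1 : m'.real (⊤ : {s : Set Ω₁ // MeasurableSet s}) = 1 := by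
    rw [hm'a, top_inf_eq]
    exact inv_mul_cancel₀ hα0.ne'
  have hJ'top : J' (L1.indicator 𝕜 m' ⊤) = g := by
    rw [hJ'ind, top_inf_eq]
  have hTf : 0 < ‖T f‖ := by
    have := L1.integral_re_le_norm (T f)
    linarith
  -- Any positive unit vector serves as `w`; normalized `|T f|` is at hand since `T f ≠ 0`.
  obtain ⟨S, hS1, hSa, hTS⟩ := L1.exists_near_of_integral (T.comp J')
    ((ContinuousLinearMap.opNorm_comp_le _ _).trans
      (mul_le_one₀ hT (norm_nonneg _) (L1.norm_mulCLM_le _ _)))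
    (w := L1.pointwiseNorm (((‖T f‖⁻¹ : ℝ) : 𝕜) • T f)) (L1.pointwiseNorm_nonneg _)
    (by rw [L1.norm_pointwiseNorm, norm_smul, RCLike.norm_ofReal, abs_of_pos (inv_pos.2 hTf),
          inv_mul_cancel₀ hTf.ne']) hδ0
    (fun a => by
      rw [← L1.reIntegral_apply, ContinuousLinearMap.comp_apply, hJ'ind, hm'a, map_smul,
        RCLike.real_smul_eq_coe_smul (K := 𝕜) α⁻¹ _ |>.symm, map_smul, smul_eq_mul,
        mul_left_comm]
      exact mul_le_mul_of_nonneg_left (hA _ inf_le_right) (inv_pos.2 hα0).le)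
  obtain ⟨R, hR1, hRS, hTR⟩ := L1.exists_extension hgk T hT S hS1
  refine ⟨R, g, hR1, ?_, ?_, ?_, hTR.trans hTS⟩
  · rw [← hJ'top, hJ'n, L1.norm_indicator, hm'1]
  · rw [← hJ'top, hRS, hSa, hm'1]
  -- Each of the two terms has norm `1 - α < η / δ`.
  · have : f - g = J (L1.indicator 𝕜 m Aᶜ) - (((α⁻¹ - 1 : ℝ)) : 𝕜) • J (L1.indicator 𝕜 m A) := by
      rw [hg, ← hJtop, hsplit, map_add]
      push_cast
      module
    rw [this]
    refine (norm_sub_le _ _).trans ?_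
    have h0 : 0 ≤ α⁻¹ - 1 := sub_nonneg.2 ((one_le_inv₀ hα0).2 hα1')
    rw [norm_smul, hJn, hJn, L1.norm_indicator, L1.norm_indicator, RCLike.norm_ofReal,
      abs_of_nonneg h0, ← hα, sub_mul, inv_mul_cancel₀ hα0.ne']
    linarith

/-- A unimodular function turning `y` into its modulus. -/
theorem exists_unimodular_mul_eq_norm {y : Ω₂ → 𝕜} (hy : Measurable y) :
    ∃ k : Ω₂ → 𝕜, Measurable k ∧ (∀ x, ‖k x‖ = 1) ∧ ∀ x, k x * y x = (‖y x‖ : ℝ) := by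
  classical
  refine ⟨fun x => if y x = 0 then 1 else (starRingEnd 𝕜) (y x) / (‖y x‖ : ℝ), ?_, fun x => ?_,
    fun x => ?_⟩
  · refine Measurable.ite (hy (measurableSet_singleton 0)) measurable_const ?_
    exact (RCLike.continuous_conj.measurable.comp hy).div
      (RCLike.measurable_ofReal.comp hy.norm)
  · by_cases hx : y x = 0
    · simp [hx]
    · simp [hx]
  · by_cases hx : y x = 0
    · simp [hx]
    · have : ((‖y x‖ : ℝ) : 𝕜) ≠ 0 := by simpa using hx
      simp only [hx, if_false]
      rw [div_mul_eq_mul_div, RCLike.conj_mul]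
      field_simp

/-- A quantitative Bishop–Phelps–Bollobás theorem for operators between `L¹` spaces. -/
theorem L1.exists_norm_attaining_near (T : Lp 𝕜 1 μ →L[𝕜] Lp 𝕜 1 ν) (f : Lp 𝕜 1 μ)
    (hT : ‖T‖ ≤ 1) (hf : ‖f‖ = 1) {δ η : ℝ} (hδ0 : 0 < δ) (hηδ : η ≤ δ) (hη1 : η ≤ 1)
    (h : 1 - η < ‖T f‖) :
    ∃ (S : Lp 𝕜 1 μ →L[𝕜] Lp 𝕜 1 ν) (g : Lp 𝕜 1 μ), ‖S‖ = 1 ∧ ‖g‖ = 1 ∧ ‖S g‖ = 1 ∧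
      ‖f - g‖ ≤ 2 * (η / δ) ∧ ‖T - S‖ ≤ Real.sqrt (2 * δ) + δ := by
  obtain ⟨k, hk, hk1, hky⟩ := exists_unimodular_mul_eq_norm (L1.measurable_coeFn (T f))
  have hkinv : ∀ x, ‖(k x)⁻¹‖ = 1 := fun x => by rw [norm_inv, hk1, inv_one]
  have hden : ∀ {l : Ω₂ → 𝕜}, (∀ x, ‖l x‖ = 1) → ν.withDensity (fun x => ‖l x‖ₑ) = ν := by
    intro l hl
    have : (fun x => ‖l x‖ₑ) = 1 := funext fun x => by simp [← ofReal_norm, hl]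
    rw [this, withDensity_one]
  -- `Φ` turns `T f` into its modulus; its inverse `Ψ` is an isometry and undoes this at the end.
  set Φ : Lp 𝕜 1 ν →L[𝕜] Lp 𝕜 1 ν := L1.mulCLM k hk (hden hk1).le
  set Ψ : Lp 𝕜 1 ν →L[𝕜] Lp 𝕜 1 ν := L1.mulCLM (fun x => (k x)⁻¹) hk.inv (hden hkinv).le
  have hΨn : ∀ u, ‖Ψ u‖ = ‖u‖ := L1.norm_mulCLM_apply hk.inv (hden hkinv)
  have hΨΦ : ∀ u, Ψ (Φ u) = u := fun u => by
    ext1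
    filter_upwards [L1.coeFn_mulCLM_mulCLM hk hk.inv (hden hk1).le (hden hkinv).le u] with x hx
    have : k x ≠ 0 := norm_ne_zero_iff.1 (by rw [hk1]; exact one_ne_zero)
    exact hx.trans (inv_mul_cancel_left₀ this _)
  have hre : ∫ x, RCLike.re ((Φ.comp T) f x) ∂ν = ‖T f‖ := by
    rw [L1.norm_eq_integral_norm]
    refine integral_congr_ae ?_
    filter_upwards [L1.coeFn_mulCLM hk (hden hk1).le (T f)] with x hx
    change RCLike.re (L1.mulCLM k hk (hden hk1).le (T f) x) = _
    rw [hx, hky, RCLike.ofReal_re]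
  obtain ⟨S, g, hS1, hg1, hSg, hfg, hTS⟩ := L1.exists_approx_of_reIntegral (Φ.comp T) f
    ((ContinuousLinearMap.opNorm_comp_le _ _).trans
      (mul_le_one₀ (L1.norm_mulCLM_le _ _) (norm_nonneg _) hT)) hf hδ0 hηδ hη1 (by rwa [hre])
  have hΨS : ‖(Ψ.comp S) g‖ = 1 := by rw [ContinuousLinearMap.comp_apply, hΨn, hSg]
  refine ⟨Ψ.comp S, g, le_antisymm ?_ ?_, hg1, hΨS, hfg, ?_⟩
  · exact (ContinuousLinearMap.opNorm_comp_le _ _).trans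
      (mul_le_one₀ (L1.norm_mulCLM_le _ _) (norm_nonneg _) hS1)
  · have := (Ψ.comp S).le_opNorm g
    rwa [hΨS, hg1, mul_one] at this
  · have : T - Ψ.comp S = Ψ.comp (Φ.comp T - S) := by
      ext1 u
      simp [hΨΦ]
    rw [this]
    refine ((ContinuousLinearMap.opNorm_comp_le _ _).trans ?_).trans hTS
    exact mul_le_of_le_one_left (norm_nonneg _) (L1.norm_mulCLM_le _ _)

/-- The theorem `L1.exists_norm_attaining_near` with simpler estimates. -/
theorem L1.exists_norm_attaining_lt (T : Lp 𝕜 1 μ →L[𝕜] Lp 𝕜 1 ν) (f : Lp 𝕜 1 μ)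
    (hT : ‖T‖ ≤ 1) (hf : ‖f‖ = 1) {δ : ℝ} (hδ0 : 0 < δ) (hδ1 : δ < 1) (h : 1 - δ ^ 2 < ‖T f‖) :
    ∃ (S : Lp 𝕜 1 μ →L[𝕜] Lp 𝕜 1 ν) (g : Lp 𝕜 1 μ), ‖S‖ = 1 ∧ ‖g‖ = 1 ∧ ‖S g‖ = 1 ∧
      ‖f - g‖ < 4 * δ ∧ ‖T - S‖ < 4 * Real.sqrt δ := by
  -- Taken with `η = δ ^ 2`, so that `2 * (η / δ) = 2 * δ`.
  obtain ⟨S, g, hS, hg, hSg, hfg, hTS⟩ := L1.exists_norm_attaining_near T f hT hf hδ0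
    (by nlinarith) (by nlinarith) h
  have hs0 : 0 < Real.sqrt δ := Real.sqrt_pos.2 hδ0
  have hss : Real.sqrt δ * Real.sqrt δ = δ := Real.mul_self_sqrt hδ0.le
  have hs1 : Real.sqrt δ < 1 := by nlinarith
  have h2 : Real.sqrt (2 * δ) ≤ 2 * Real.sqrt δ :=
    Real.sqrt_le_iff.2 ⟨by positivity, by nlinarith⟩
  refine ⟨S, g, hS, hg, hSg, hfg.trans_lt ?_, hTS.trans_lt (by nlinarith)⟩
  rw [sq, mul_div_assoc, div_self hδ0.ne', mul_one]
  linarith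

variable (μ ν) in
theorem L1.exists_bpb_pair {ε : ℝ} (hε0 : 0 < ε) (hε1 : ε < 1)
    (T : Lp 𝕜 1 μ →L[𝕜] Lp 𝕜 1 ν) (f : Lp 𝕜 1 μ) (hT : ‖T‖ = 1) (hf : ‖f‖ = 1)
    (h : 1 - (ε ^ 2 / 16) ^ 2 < ‖T f‖) :
    ∃ (g : Lp 𝕜 1 μ) (S : Lp 𝕜 1 μ →L[𝕜] Lp 𝕜 1 ν), ‖g‖ = 1 ∧ ‖S‖ = 1 ∧ ‖S g‖ = 1 ∧
      ‖g - f‖ < ε ∧ ‖S - T‖ < ε := by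
  -- `δ = ε ^ 2 / 16` makes `4 * √δ` equal to `ε`, and `4 * δ = ε ^ 2 / 4 < ε`.
  obtain ⟨S, g, hS, hg, hSg, hfg, hTS⟩ := L1.exists_norm_attaining_lt T f hT.le hf
    (by positivity : 0 < ε ^ 2 / 16) (by nlinarith) h
  have hsq : Real.sqrt (ε ^ 2 / 16) = ε / 4 := by
    rw [show ε ^ 2 / 16 = (ε / 4) ^ 2 by ring, Real.sqrt_sq (by positivity)]
  rw [hsq] at hTS
  refine ⟨g, S, hg, hS, hSg, ?_, ?_⟩
  · rw [norm_sub_rev]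
    nlinarith
  · rw [norm_sub_rev]
    linarith

variable (μ ν) in
theorem le_bpbModulus {ε : ℝ} (hε0 : 0 < ε) (hε1 : ε < 1) :
    ENNReal.ofReal ((ε ^ 2 / 16) ^ 2) ≤ bpbModulus 𝕜 (Lp 𝕜 1 μ) (Lp 𝕜 1 ν) ε := by
  refine le_iInf fun f => le_iInf fun T => le_iInf fun hf => le_iInf fun hT => le_iInf fun hd => ?_
  refine ENNReal.ofReal_le_ofReal ?_
  by_contra hlt
  obtain ⟨g, S, hg, hS, hSg, hfg, hTS⟩ := L1.exists_bpb_pair μ ν hε0 hε1 T f hT hf (by linarith)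
  have hmem : (g, S) ∈ normAttainingPairs 𝕜 (Lp 𝕜 1 μ) (Lp 𝕜 1 ν) := ⟨hS, hg, hSg⟩
  refine (hd.trans (Metric.infEDist_le_edist_of_mem hmem)).not_gt ?_
  rw [edist_dist, ENNReal.ofReal_lt_ofReal_iff hε0, Prod.dist_eq, max_lt_iff, dist_comm,
    dist_eq_norm, dist_comm, dist_eq_norm]
  exact ⟨hfg, hTS⟩

end BishopPhelpsBollobas

theorem theorem3p1 (𝕜 : Type w) [RCLike 𝕜] :
    -- the property for all pairs of measures
    (∀ (Ω₁ : Type u) [MeasurableSpace Ω₁] (μ : Measure Ω₁)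
        (Ω₂ : Type v) [MeasurableSpace Ω₂] (ν : Measure Ω₂),
        HasBPBp 𝕜 (Lp 𝕜 1 μ) (Lp 𝕜 1 ν)) ∧
    -- a lower bound for the modulus that does not depend on the measures
    (∃ η : ℝ → ℝ, (∀ ε : ℝ, 0 < ε → ε < 1 → 0 < η ε) ∧
      ∀ (Ω₁ : Type u) [MeasurableSpace Ω₁] (μ : Measure Ω₁)
        (Ω₂ : Type v) [MeasurableSpace Ω₂] (ν : Measure Ω₂) (ε : ℝ), 0 < ε → ε < 1 →
        ENNReal.ofReal (η ε) ≤ bpbModulus 𝕜 (Lp 𝕜 1 μ) (Lp 𝕜 1 ν) ε) ∧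
    -- the quantitative form on compact Hausdorff spaces
    (∀ (J₁ : Type u) [TopologicalSpace J₁] [CompactSpace J₁] [T2Space J₁]
        [MeasurableSpace J₁] [BorelSpace J₁] (m₁ : Measure J₁) [IsFiniteMeasure m₁] [m₁.Regular]
        (J₂ : Type v) [TopologicalSpace J₂] [CompactSpace J₂] [T2Space J₂]
        [MeasurableSpace J₂] [BorelSpace J₂] (m₂ : Measure J₂) [IsFiniteMeasure m₂] [m₂.Regular]
        (ε : ℝ), 0 < ε → ε < 1 →
        ∀ (T : Lp 𝕜 1 m₁ →L[𝕜] Lp 𝕜 1 m₂) (f : Lp 𝕜 1 m₁), ‖T‖ = 1 → ‖f‖ = 1 →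
          1 - ε ^ 18 / (5 ^ 3 * 2 ^ 27) < ‖T f‖ →
          ∃ (S : Lp 𝕜 1 m₁ →L[𝕜] Lp 𝕜 1 m₂) (g : Lp 𝕜 1 m₁), ‖S‖ = 1 ∧ ‖g‖ = 1 ∧
            ‖S g‖ = 1 ∧ ‖f - g‖ < 4 * ε ∧ ‖T - S‖ < 4 * Real.sqrt ε) := by
  refine ⟨fun Ω₁ _ μ Ω₂ _ ν ε hε0 hε1 => ⟨(ε ^ 2 / 16) ^ 2, by positivity,
      fun T f hT hf h => L1.exists_bpb_pair μ ν hε0 hε1 T f hT hf h⟩,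
    ⟨fun ε => (ε ^ 2 / 16) ^ 2, fun ε hε0 _ => by positivity,
      fun Ω₁ _ μ Ω₂ _ ν ε hε0 hε1 => le_bpbModulus μ ν hε0 hε1⟩, ?_⟩
  intro J₁ _ _ _ _ _ m₁ _ _ J₂ _ _ _ _ _ m₂ _ _ ε hε0 hε1 T f hT hf h
  -- With `δ = ε` a defect below `ε ^ 2` already suffices, far weaker than the one assumed.
  refine L1.exists_norm_attaining_lt T f hT.le hf hε0 hε1 (lt_of_le_of_lt ?_ h)
  have h1 : ε ^ 18 ≤ ε ^ 2 := pow_le_pow_of_le_one hε0.le hε1.le (by norm_num)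
  have h2 : ε ^ 18 / (5 ^ 3 * 2 ^ 27) ≤ ε ^ 18 := div_le_self (by positivity) (by norm_num)
  linarith
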